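/- Let $G$ be a finite group, $\operatorname{Irr} G$ the set of its irreducible complex characters and $\operatorname{Cl}(G)$ the set of its conjugacy classes. For $X\subseteq \operatorname{Irr} G$ put $\sigma_X=\sum_{\chi\in X}\chi(1)\chi$. For a set $\mathcal X$ of subsets of $\operatorname{Irr} G$, let $\operatorname{Clpt}(\mathcal X)$ be the partition of $G$ into the equivalence classes of the relation: $g\sim h$ if and only if $\sigma_X(g)=\sigma_X(h)$ for all $X\in\mathcal X$. For a set $\mathcal K$ of $G$-invariant subsets of $G$ (unions of conjugacy classes), let $\operatorname{Irpt}(\mathcal K)$ be the partition of $\operatorname{Irr} G$ into the equivalence classes of the relation: $\chi\sim\psi$ if and only if $\chi(\hat K)/\chi(1)=\psi(\hat K)/\psi(1)$ for all $K\in\mathcal K$, where $\hat K=\sum_{g\in K}g\in\mathbb C G$ and characters are extended linearly to $\mathbb C G$. A supercharacter theory of $G$ is a pair $(\mathcal X,\mathcal K)$, where $\mathcal X$ is a partition of $\operatorname{Irr} G$ and $\mathcal K$ is a partition of $G$, such that $|\mathcal X|=|\mathcal K|$ and every $\sigma_X$ ($X\in\mathcal X$) is constant on every member of $\mathcal K$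 (the members of $\mathcal K$ are then automatically $G$-invariant). A table automorphism is a pair $(\sigma,\tau)$, where $\sigma$ is a permutation of $\operatorname{Irr} G$ and $\tau$ is a permutation of $\operatorname{Cl}(G)$, such that $\chi^\sigma(g^\tau)=\chi(g)$ for all $\chi\in\operatorname{Irr} G$ and $g\in G$, where $g^\tau$ denotes any element of the image under $\tau$ of the conjugacy class of $g$. For such a pair write $X^\sigma=\{\chi^\sigma:\chi\in X\}$ and $\mathcal X^\sigma=\{X^\sigma:X\in\mathcal X\}$; for $G$-invariant $K\subseteq G$ let $K^\tau$ be the union of the images under $\tau$ of the conjugacy classes contained in $K$, and $\mathcal K^\tau=\{K^\tau:K\in\mathcal K\}$. **Lemma.** Let $(\sigma,\tau)$ be a table automorphism of the character table of $G$. Then: 1. $\operatorname{Clpt}(\mathcal X^\sigma)=\operatorname{Clpt}(\mathcal X)^\tau$ for any collection $\mathcal X$ of subsets of $\operatorname{Irr} G$; 2. $\operatorname{Irpt}(\mathcal K^\tau)=\operatorname{Irpt}(\mathcal K)^\sigma$ for any collection $\mathcal K$ of $G$-invariant subsets of $G$; 3. if $(\mathcal X,\mathcal K)$ is a supercharacter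 theory of $G$, then so is $(\mathcal X^\sigma,\mathcal K^\tau)$. -/

import Mathlib

universe u v

namespace Supercharacter

/-- `χ : G → ℂ` is an irreducible complex character: the character of an irreducible
representation of `G` on some `ℂ^n`. -/
def IsIrrChar {G : Type u} [Group G] (χ : G → ℂ) : Prop :=
  ∃ (n : ℕ) (ρ : Representation ℂ G (Fin n → ℂ)), ρ.IsIrreducible ∧ ρ.character = χ

/-- The set `Irr G` of irreducible complex characters of `G`, as a type. -/
abbrev Irr (G : Type u) [Group G] : Type u := {χ : G → ℂ // IsIrrChar χ}

/-- The character of any finite-dimensional irreducible representation, on a vector space in any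
universe, belongs to `Irr G`. -/
theorem isIrrChar_character {G : Type u} [Group G] {V : Type v} [AddCommGroup V] [Module ℂ V]
    [FiniteDimensional ℂ V] (ρ : Representation ℂ G V) (hρ : ρ.IsIrreducible) :
    IsIrrChar ρ.character := by
  let e : V ≃ₗ[ℂ] (Fin (Module.finrank ℂ V) → ℂ) := (Module.finBasis ℂ V).equivFun
  let ρ' : Representation ℂ G (Fin (Module.finrank ℂ V) → ℂ) :=
    { toFun := fun g => e.conj (ρ g)
      map_one' := by ext; simp [LinearEquiv.conj_apply]
      map_mul' := fun g h => by rw [map_mul, Module.End.mul_eq_comp, LinearEquiv.conj_comp]; rfl }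
  have key : ∀ g v, ρ' g (e v) = e (ρ g v) := fun g v => by
    simp [ρ', LinearEquiv.conj_apply]
  have hchar : ρ'.character = ρ.character := by
    funext g
    exact LinearMap.trace_conj' (ρ g) e
  let F : Subrepresentation ρ' ≃o Subrepresentation ρ :=
    { toFun := fun W => ⟨W.toSubmodule.comap e.toLinearMap, fun g v hv => by
        have h := W.apply_mem_toSubmodule g hv
        change e (ρ g v) ∈ W.toSubmodule
        rw [← key]
        exact h⟩
      invFun := fun W => ⟨W.toSubmodule.comap e.symm.toLinearMap, fun g v hv => by
        have h := W.apply_mem_toSubmodule g hv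
        obtain ⟨w, rfl⟩ := e.surjective v
        change e.symm (ρ' g (e w)) ∈ W.toSubmodule
        rw [key, e.symm_apply_apply]
        simpa using h⟩
      left_inv := fun W => by
        apply Subrepresentation.toSubmodule_injective
        ext v
        simp
      right_inv := fun W => by
        apply Subrepresentation.toSubmodule_injective
        ext v
        simp
      map_rel_iff' := by
        intro W₁ W₂
        constructor
        · intro h v hv
          obtain ⟨w, rfl⟩ := e.surjective v
          exact h (show w ∈ W₁.toSubmodule.comap e.toLinearMap from hv)
        · intro h v hv
          exact h (show e v ∈ W₁ from hv) }
  exact ⟨_, ρ', F.isSimpleOrder_iff.mpr hρ, hchar⟩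

/-- The irreducible characters of a finite group are linearly independent. -/
theorem linearIndependent_irr (G : Type u) [Group G] [Finite G] :
    LinearIndependent ℂ (fun χ : Irr G => χ.1) := by
  classical
  have := Fintype.ofFinite G
  have hc : (Nat.card G : ℂ) ≠ 0 := Nat.cast_ne_zero.mpr Nat.card_pos.ne'
  let _ : Invertible (Nat.card G : ℂ) := invertibleOfNonzero hc
  have orth : ∀ χ ψ : Irr G,
      (Nat.card G : ℂ)⁻¹ * ∑ g : G, χ.1 g * ψ.1 g⁻¹ = if χ = ψ then 1 else 0 := by
    rintro ⟨χ, n, ρ, hρ, rfl⟩ ⟨ψ, m, θ, hθ, rfl⟩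
    rw [Representation.char_orthonormal]
    by_cases h : Nonempty (θ.Equiv ρ)
    · obtain ⟨φ⟩ := h
      have h' := Representation.char_iso φ
      rw [if_pos ⟨φ⟩, if_pos (Subtype.ext h'.symm)]
    · have h1 := Representation.char_orthonormal ρ θ
      have h2 := Representation.char_orthonormal ρ ρ
      rw [if_neg h] at h1
      rw [if_pos ⟨Representation.Equiv.refl ρ⟩] at h2
      rw [if_neg h, if_neg]
      intro h3
      have h4 : ρ.character = θ.character := congrArg Subtype.val h3
      rw [← h4, h2] at h1
      exact one_ne_zero h1
  rw [linearIndependent_iff']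
  intro s c hs ψ hψ
  have h : (Nat.card G : ℂ)⁻¹ * ∑ g : G, (∑ χ ∈ s, c χ • χ.1) g * ψ.1 g⁻¹ = c ψ := by
    calc (Nat.card G : ℂ)⁻¹ * ∑ g : G, (∑ χ ∈ s, c χ • χ.1) g * ψ.1 g⁻¹
        = ∑ χ ∈ s, c χ * ((Nat.card G : ℂ)⁻¹ * ∑ g : G, χ.1 g * ψ.1 g⁻¹) := by
          simp only [Finset.sum_apply, Pi.smul_apply, smul_eq_mul, Finset.sum_mul, Finset.mul_sum]
          rw [Finset.sum_comm]
          refine Finset.sum_congr rfl fun χ _ => Finset.sum_congr rfl fun g _ => ?_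
          ring
      _ = c ψ := by
          simp only [orth]
          simp [hψ]
  rw [← h, hs]
  simp

/-- A finite group has only finitely many irreducible characters. -/
instance instFiniteIrr {G : Type u} [Group G] [Finite G] : Finite (Irr G) :=
  (linearIndependent_irr G).finite

/-- The character `σ_X = ∑_{χ ∈ X} χ(1) χ` attached to a subset `X` of `Irr G`. -/
noncomputable def sigma {G : Type u} [Group G] [Finite G] (X : Set (Irr G)) : G → ℂ :=
  ∑ χ ∈ X.toFinite.toFinset, χ.1 1 • χ.1

/-- The relation `g ∼ h` iff `σ_X(g) = σ_X(h)` for all `X ∈ 𝒳`. -/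
def clRel {G : Type u} [Group G] [Finite G] (𝒳 : Set (Set (Irr G))) : Setoid G where
  r g h := ∀ X ∈ 𝒳, sigma X g = sigma X h
  iseqv := ⟨fun _ _ _ => rfl, fun h X hX => (h X hX).symm,
    fun h₁ h₂ X hX => (h₁ X hX).trans (h₂ X hX)⟩

/-- The class partition `Clpt(𝒳)`: the partition of `G` into the equivalence classes of
`clRel 𝒳`. -/
def Clpt {G : Type u} [Group G] [Finite G] (𝒳 : Set (Set (Irr G))) : Set (Set G) :=
  (clRel 𝒳).classes

/-- The element `∑_{g ∈ K} g` of the group algebra `ℂ[G]`. -/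
noncomputable def blockSum {G : Type u} [Group G] [Finite G] (K : Set G) : MonoidAlgebra ℂ G :=
  ∑ g ∈ K.toFinite.toFinset, MonoidAlgebra.of ℂ G g

/-- The value `χ(z) = ∑_g z_g χ(g)` at `z ∈ ℂ[G]` of the linear extension of `χ : G → ℂ`. -/
noncomputable def linExt {G : Type u} [Group G] (χ : G → ℂ) (z : MonoidAlgebra ℂ G) : ℂ :=
  z.coeff.sum fun g c => c * χ g

theorem linExt_blockSum {G : Type u} [Group G] [Finite G] (χ : G → ℂ) (K : Set G) :
    linExt χ (blockSum K) = ∑ g ∈ K.toFinite.toFinset, χ g := by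
  classical
  have hadd : ∀ z w : MonoidAlgebra ℂ G, linExt χ (z + w) = linExt χ z + linExt χ w := by
    intro z w
    exact Finsupp.sum_add_index' (fun _ => zero_mul _) (fun _ _ _ => add_mul _ _ _)
  have hzero : linExt χ 0 = 0 := Finsupp.sum_zero_index
  have hof : ∀ g, linExt χ (MonoidAlgebra.of ℂ G g) = χ g := by
    intro g
    simp [linExt]
  unfold blockSum
  induction K.toFinite.toFinset using Finset.induction_on with
  | empty => simpa using hzero
  | insert a s ha ih => rw [Finset.sum_insert ha, Finset.sum_insert ha, hadd, hof, ih]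

/-- The relation `χ ∼ ψ` iff `χ(K̂)/χ(1) = ψ(K̂)/ψ(1)` for all `K ∈ 𝒦`, where `K̂` is the sum of
the elements of `K` in the group algebra. -/
def irRel {G : Type u} [Group G] [Finite G] (𝒦 : Set (Set G)) : Setoid (Irr G) where
  r χ ψ := ∀ K ∈ 𝒦, linExt χ.1 (blockSum K) / χ.1 1 = linExt ψ.1 (blockSum K) / ψ.1 1
  iseqv := ⟨fun _ _ _ => rfl, fun h K hK => (h K hK).symm,
    fun h₁ h₂ K hK => (h₁ K hK).trans (h₂ K hK)⟩

/-- The character partition `Irpt(𝒦)`: the partition of `Irr G` into the equivalence classes of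
`irRel 𝒦`. -/
def Irpt {G : Type u} [Group G] [Finite G] (𝒦 : Set (Set G)) : Set (Set (Irr G)) :=
  (irRel 𝒦).classes

/-- A subset of `G` is `G`-invariant (normal) if it is a union of conjugacy classes. -/
def IsInvariant {G : Type u} [Group G] (K : Set G) : Prop :=
  ∀ g ∈ K, ∀ x : G, x * g * x⁻¹ ∈ K

/-- `(𝒳, 𝒦)` is a supercharacter theory of `G`. -/
structure IsSupercharacterTheory {G : Type u} [Group G] [Finite G]
    (𝒳 : Set (Set (Irr G))) (𝒦 : Set (Set G)) : Prop where
  isPartition_irr : Setoid.IsPartition 𝒳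
  isPartition_group : Setoid.IsPartition 𝒦
  ncard_eq : 𝒳.ncard = 𝒦.ncard
  constant : ∀ X ∈ 𝒳, ∀ K ∈ 𝒦, ∀ g ∈ K, ∀ h ∈ K, sigma X g = sigma X h

/-- `(σ, τ)` is a table automorphism: `χ^σ(g^τ) = χ(g)` for every `χ ∈ Irr G` and `g ∈ G`, where
`g^τ` stands for any element `h` of the image under `τ` of the conjugacy class of `g`. -/
def IsTableAutomorphism {G : Type u} [Group G]
    (σ : Equiv.Perm (Irr G)) (τ : Equiv.Perm (ConjClasses G)) : Prop :=
  ∀ (χ : Irr G) (g h : G), ConjClasses.mk h = τ (ConjClasses.mk g) → (σ χ).1 h = χ.1 g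

/-- `𝒳^σ = {X^σ : X ∈ 𝒳}` for a collection `𝒳` of subsets of `Irr G`, where
`X^σ = {χ^σ : χ ∈ X}`. -/
def irrImage {G : Type u} [Group G] (σ : Equiv.Perm (Irr G)) (𝒳 : Set (Set (Irr G))) :
    Set (Set (Irr G)) :=
  (fun X => σ '' X) '' 𝒳

/-- `K^τ`, the union of the classes `(g^G)^τ` for `g ∈ K`. -/
def blockImage {G : Type u} [Group G] (τ : Equiv.Perm (ConjClasses G)) (K : Set G) : Set G :=
  {h | ∃ g ∈ K, ConjClasses.mk h = τ (ConjClasses.mk g)}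

/-- `𝒦^τ = {K^τ : K ∈ 𝒦}` for a collection `𝒦` of subsets of `G`. -/
def groupImage {G : Type u} [Group G] (τ : Equiv.Perm (ConjClasses G)) (𝒦 : Set (Set G)) :
    Set (Set G) :=
  blockImage τ '' 𝒦

end Supercharacter

namespace Supercharacter

open Module

/-! Everything rests on two facts: a table automorphism preserves degrees and class sizes. Degrees:
for z in the image of the class of 1, |χ(1)| = |χ^σ(z)| ≤ |χ^σ(1)|. Summed over `Irr G`, which σ
permutes, both ends agree, so equality holds for every χ. Class sizes: σ fixes the trivial
character, so the sums of χ and χ^σ over G agree. Hence the class function C ↦ (|C^τ| - |C|)/|C| is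
orthogonal to every irreducible character, and it vanishes by completeness. Preserved degrees give
σ_{X^σ}(g^τ) = σ_X(g). Preserved class sizes give equal values of χ^σ and χ on the sums over K^τ and
K. So the two defining relations are carried across by σ and τ. For supercharacter theories,
invariance of the blocks also makes τ act injectively on them. -/

/-! ### Values and degrees of irreducible characters -/

theorem Irr.apply_eq_of_isConj {G : Type u} [Group G] (χ : Irr G) {g h : G} (H : IsConj g h) :
    χ.1 g = χ.1 h := by
  obtain ⟨_, n, ρ, -, rfl⟩ := χ
  obtain ⟨c, rfl⟩ := isConj_iff.mp H
  exact (ρ.char_conj g c).symm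

theorem Irr.apply_one {G : Type u} [Group G] (χ : Irr G) :
    ∃ d : ℕ, 0 < d ∧ χ.1 1 = d := by
  obtain ⟨_, n, ρ, hρ, rfl⟩ := χ
  refine ⟨n, ?_, by simp⟩
  rcases Nat.eq_zero_or_pos n with rfl | h
  · have : Subsingleton (Subrepresentation ρ) := ⟨fun A B => by
      apply Subrepresentation.toSubmodule_injective
      exact Subsingleton.elim _ _⟩
    exact absurd this (not_subsingleton _)
  · exact h

theorem Irr.apply_one_ne_zero {G : Type u} [Group G] (χ : Irr G) : χ.1 1 ≠ 0 := by
  obtain ⟨d, hd, h⟩ := χ.apply_one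
  rw [h]
  exact_mod_cast hd.ne'

/-- An endomorphism of finite order has eigenvalues on the unit circle, so its trace is bounded by
the dimension. -/
theorem norm_trace_le_finrank {V : Type v} [AddCommGroup V] [Module ℂ V] [FiniteDimensional ℂ V]
    (f : End ℂ V) {n : ℕ} (hn : n ≠ 0) (hf : f ^ n = 1) :
    ‖LinearMap.trace ℂ V f‖ ≤ finrank ℂ V := by
  have hs : f.charpoly.Splits := IsAlgClosed.splits _
  rw [End.trace_eq_sum_roots_charpoly_of_splits hs]
  have h1 : ∀ μ ∈ f.charpoly.roots, ‖μ‖ = 1 := by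
    intro μ hμ
    have he := (End.hasEigenvalue_iff_isRoot_charpoly f μ).mpr (Polynomial.isRoot_of_mem_roots hμ)
    obtain ⟨v, hv⟩ := he.exists_hasEigenvector
    have h2 := hv.pow_apply n
    rw [hf, End.one_apply] at h2
    have h3 : (μ ^ n - 1) • v = 0 := by rw [sub_smul, ← h2, one_smul, sub_self]
    have h4 : μ ^ n = 1 := sub_eq_zero.mp ((smul_eq_zero.mp h3).resolve_right hv.2)
    exact Complex.norm_eq_one_of_pow_eq_one h4 hn
  calc ‖f.charpoly.roots.sum‖ ≤ (f.charpoly.roots.map fun μ => ‖μ‖).sum :=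
        norm_multiset_sum_le _
    _ = f.charpoly.roots.card := by
        rw [Multiset.map_congr rfl h1]
        simp
    _ = finrank ℂ V := by
        rw [← hs.natDegree_eq_card_roots, LinearMap.charpoly_natDegree]

theorem Irr.norm_apply_le {G : Type u} [Group G] [Finite G] (χ : Irr G) (g : G) :
    ‖χ.1 g‖ ≤ ‖χ.1 1‖ := by
  obtain ⟨_, n, ρ, hρ, rfl⟩ := χ
  have h := norm_trace_le_finrank (ρ g) (n := Nat.card G) Nat.card_pos.ne'
    (by rw [← map_pow, pow_card_eq_one', map_one])
  simpa [Representation.character] using h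

/-! ### Completeness of the irreducible characters among class functions -/

/-- By conjugation invariance of f the sum commutes with ρ, so Schur's lemma makes it a scalar; its
trace is zero, hence so is the scalar. -/
theorem asAlgebraHom_eq_zero {G : Type u} [Group G] [Fintype G] {V : Type v} [AddCommGroup V]
    [Module ℂ V] [FiniteDimensional ℂ V] (ρ : Representation ℂ G V) [hρ : ρ.IsIrreducible]
    (f : G → ℂ) (hf : ∀ g x, f (x * g * x⁻¹) = f g) (h : ∑ g, f g * ρ.character g = 0) :
    ∑ g, f g • ρ g = 0 := by
  have hcomm : ∀ x, (∑ g, f g • ρ g) * ρ x = ρ x * ∑ g, f g • ρ g := by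
    intro x
    rw [Finset.sum_mul, Finset.mul_sum]
    refine Fintype.sum_equiv (MulAut.conj x⁻¹).toEquiv _ _ fun g => ?_
    have h1 : f ((MulAut.conj x⁻¹).toEquiv g) = f g := hf g x⁻¹
    rw [h1, smul_mul_assoc, mul_smul_comm, ← map_mul, ← map_mul]
    simp [mul_assoc]
  let T : Representation.IntertwiningMap ρ ρ :=
    { toLinearMap := ∑ g, f g • ρ g
      isIntertwining' := fun x => by
        simpa [Module.End.mul_eq_comp] using hcomm x }
  obtain ⟨c, hc⟩ :=
    (Representation.IsIrreducible.algebraMap_intertwiningMap_bijective_of_isAlgClosed (ρ := ρ)).2 T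
  have hT : ∑ g, f g • ρ g = c • (1 : End ℂ V) := by
    have := congrArg (fun S : Representation.IntertwiningMap ρ ρ => S.toLinearMap) hc
    rw [Algebra.algebraMap_eq_smul_one] at this
    exact this.symm
  have htr : LinearMap.trace ℂ V (∑ g, f g • ρ g) = 0 := by
    rw [← h]
    simp [Representation.character]
  rw [hT, map_smul, LinearMap.trace_one, smul_eq_mul, mul_eq_zero] at htr
  rw [hT]
  rcases htr with hc0 | hd
  · rw [hc0, zero_smul]
  · have : Subsingleton V := finrank_zero_iff.mp (by exact_mod_cast hd)
    exact Subsingleton.elim _ _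

theorem asAlgebraHom_ofModule' {G : Type u} [Group G] (M : Type v) [AddCommGroup M] [Module ℂ M]
    [Module (MonoidAlgebra ℂ G) M] [IsScalarTower ℂ (MonoidAlgebra ℂ G) M]
    (r : MonoidAlgebra ℂ G) (v : M) :
    (Representation.ofModule' (k := ℂ) (G := G) M).asAlgebraHom r v = r • v := by
  unfold Representation.ofModule' Representation.asAlgebraHom
  rw [Equiv.apply_symm_apply]
  rfl

theorem isIrreducible_ofModule' {G : Type u} [Group G] (M : Type v) [AddCommGroup M] [Module ℂ M]
    [Module (MonoidAlgebra ℂ G) M] [IsScalarTower ℂ (MonoidAlgebra ℂ G) M]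
    [IsSimpleModule (MonoidAlgebra ℂ G) M] :
    (Representation.ofModule' (k := ℂ) (G := G) M).IsIrreducible := by
  rw [Representation.irreducible_iff_isSimpleModule_asModule]
  let ρ := Representation.ofModule' (k := ℂ) (G := G) M
  let e : ρ.asModule ≃ₗ[MonoidAlgebra ℂ G] M :=
    { ρ.asModuleEquiv.toAddEquiv with
      map_smul' := fun r x => by
        have h := ρ.asModuleEquiv_map_smul r x
        rw [asAlgebraHom_ofModule'] at h
        exact h }
  exact IsSimpleModule.congr e

/-- A class function orthogonal to all irreducible characters vanishes. -/
theorem eq_zero_of_sum_mul_irr_eq_zero {G : Type u} [Group G] [Fintype G]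
    (f : G → ℂ) (hf : ∀ g x, f (x * g * x⁻¹) = f g)
    (h : ∀ χ : Irr G, ∑ g, f g * χ.1 g = 0) : f = 0 := by
  classical
  let z : MonoidAlgebra ℂ G := ∑ g, MonoidAlgebra.single g (f g)
  have : NeZero (Nat.card G : ℂ) := ⟨Nat.cast_ne_zero.mpr Nat.card_pos.ne'⟩
  -- For a maximal left ideal m the quotient by m is an irreducible representation. There z acts as
  -- zero, and applying z to the class of 1 gives z ∈ m.
  have hz : z ∈ Ring.jacobson (MonoidAlgebra ℂ G) := by
    rw [Ring.jacobson_eq_sInf_isMaximal, Submodule.mem_sInf]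
    intro m hm
    have hsimple : IsSimpleModule (MonoidAlgebra ℂ G) (MonoidAlgebra ℂ G ⧸ m) :=
      isSimpleModule_iff_isCoatom.mpr (Ideal.isMaximal_def.mp hm)
    let ρ := Representation.ofModule' (k := ℂ) (G := G) (MonoidAlgebra ℂ G ⧸ m)
    have hfin : Module.Finite ℂ (MonoidAlgebra ℂ G ⧸ m) :=
      Module.Finite.trans (MonoidAlgebra ℂ G) _
    have hρ : ρ.IsIrreducible := isIrreducible_ofModule' _
    have h0 := asAlgebraHom_eq_zero ρ f hf (h ⟨_, isIrrChar_character ρ hρ⟩)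
    have h1 : ρ.asAlgebraHom z = 0 := by
      rw [← h0]
      simp [z]
    have h2 := asAlgebraHom_ofModule' (MonoidAlgebra ℂ G ⧸ m) z (Submodule.Quotient.mk 1)
    change ρ.asAlgebraHom z _ = _ at h2
    rw [h1, LinearMap.zero_apply, eq_comm, ← Submodule.Quotient.mk_smul, smul_eq_mul, mul_one,
      Submodule.Quotient.mk_eq_zero] at h2
    exact h2
  -- Maschke: the group algebra is semisimple, so its radical is zero.
  rw [IsSemisimpleRing.jacobson_eq_bot, Submodule.mem_bot] at hz
  funext g
  have := congrArg (fun w : MonoidAlgebra ℂ G => w.coeff g) hz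
  simpa [z, Finsupp.single_apply] using this

/-- The sum of the values of an irreducible character over the group. -/
theorem Irr.sum_apply {G : Type u} [Group G] [Fintype G] (χ : Irr G) [Decidable (χ.1 = 1)] :
    ∑ g, χ.1 g = if χ.1 = 1 then (Nat.card G : ℂ) else 0 := by
  split_ifs with h
  · simp [h]
  · obtain ⟨_, n, ρ, hρ, rfl⟩ := χ
    have hc : (Nat.card G : ℂ) ≠ 0 := Nat.cast_ne_zero.mpr Nat.card_pos.ne'
    let _ : Invertible (Nat.card G : ℂ) := invertibleOfNonzero hc
    let θ := Representation.trivial ℂ G ℂ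
    have hθ1 : θ.character = 1 := by
      funext g
      simp [θ, Representation.character, Representation.trivial]
    have hθ : θ.IsIrreducible :=
      { exists_pair_ne := ⟨⊥, ⊤, fun h => by
          have h1 : (⊥ : Submodule ℂ ℂ) = ⊤ :=
            congrArg (fun W : Subrepresentation θ => W.toSubmodule) h
          exact bot_ne_top h1⟩
        eq_bot_or_eq_top := fun W =>
          (eq_bot_or_eq_top W.toSubmodule).imp
            (fun h => Subrepresentation.toSubmodule_injective h)
            (fun h => Subrepresentation.toSubmodule_injective h) }
    -- The sum over G is |G| times the inner product with the trivial character.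
    have horth := Representation.char_orthonormal ρ θ
    rw [if_neg, hθ1] at horth
    · simpa using horth
    · rintro ⟨φ⟩
      exact h ((Representation.char_iso φ).symm.trans hθ1)

theorem Irr.apply_out {G : Type u} [Group G] (χ : Irr G) (g : G) :
    χ.1 (Quotient.out (ConjClasses.mk g)) = χ.1 g :=
  χ.apply_eq_of_isConj (ConjClasses.mk_eq_mk_iff_isConj.mp (Quotient.out_eq _))

theorem sum_comp_mk {G : Type u} [Group G] [Fintype G] [Fintype (ConjClasses G)]
    [DecidableEq (ConjClasses G)] (F : ConjClasses G → ℂ) :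
    ∑ g : G, F (ConjClasses.mk g) =
      ∑ C, ((Finset.univ.filter fun g => ConjClasses.mk g = C).card : ℂ) * F C := by
  rw [← Finset.sum_fiberwise' Finset.univ ConjClasses.mk F]
  simp

/-! ### Degrees and class sizes under a table automorphism -/

namespace IsTableAutomorphism

section

variable {G : Type u} [Group G] {σ : Equiv.Perm (Irr G)} {τ : Equiv.Perm (ConjClasses G)}

theorem apply_out (h : IsTableAutomorphism σ τ) (χ : Irr G) (C : ConjClasses G) :
    (σ χ).1 (Quotient.out (τ C)) = χ.1 (Quotient.out C) :=
  h χ _ _ ((Quotient.out_eq _).trans (congrArg τ (Quotient.out_eq C).symm))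

theorem exists_mk_eq (τ : Equiv.Perm (ConjClasses G)) (g : G) :
    ∃ h : G, ConjClasses.mk h = τ (ConjClasses.mk g) :=
  ConjClasses.exists_rep _

theorem exists_eq_mk (τ : Equiv.Perm (ConjClasses G)) (h : G) :
    ∃ g : G, ConjClasses.mk h = τ (ConjClasses.mk g) := by
  obtain ⟨g, hg⟩ := ConjClasses.exists_rep (τ.symm (ConjClasses.mk h))
  exact ⟨g, by rw [hg, Equiv.apply_symm_apply]⟩

theorem coe_eq_one_iff (h : IsTableAutomorphism σ τ) (χ : Irr G) :
    (σ χ).1 = 1 ↔ χ.1 = 1 := by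
  constructor <;> intro h1 <;> funext g
  · obtain ⟨k, hk⟩ := exists_mk_eq τ g
    rw [← h χ g k hk, h1, Pi.one_apply, Pi.one_apply]
  · obtain ⟨k, hk⟩ := exists_eq_mk τ g
    rw [h χ k g hk, h1, Pi.one_apply, Pi.one_apply]

/-- Table automorphisms preserve character degrees. -/
theorem apply_one [Finite G] (h : IsTableAutomorphism σ τ) (χ : Irr G) :
    (σ χ).1 1 = χ.1 1 := by
  have := Fintype.ofFinite (Irr G)
  obtain ⟨z, hz⟩ := exists_mk_eq τ 1
  have hle : ∀ ψ ∈ Finset.univ, ‖ψ.1 1‖ ≤ ‖(σ ψ).1 1‖ := fun ψ _ => by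
    rw [← h ψ 1 z hz]
    exact (σ ψ).norm_apply_le z
  have hsum : ∑ ψ : Irr G, ‖ψ.1 1‖ = ∑ ψ : Irr G, ‖(σ ψ).1 1‖ :=
    (Equiv.sum_comp σ fun ψ : Irr G => ‖ψ.1 1‖).symm
  -- Termwise inequalities with equal totals are equalities.
  have heq := (Finset.sum_eq_sum_iff_of_le hle).mp hsum χ (Finset.mem_univ _)
  obtain ⟨d, -, hd⟩ := χ.apply_one
  obtain ⟨d', -, hd'⟩ := (σ χ).apply_one
  rw [hd, hd', Complex.norm_natCast, Complex.norm_natCast] at heq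
  rw [hd, hd']
  exact_mod_cast heq.symm

/-- Table automorphisms preserve the sizes of conjugacy classes. -/
theorem card_class [Fintype G] [DecidableEq (ConjClasses G)] (h : IsTableAutomorphism σ τ)
    (C : ConjClasses G) :
    (Finset.univ.filter fun g => ConjClasses.mk g = τ C).card =
      (Finset.univ.filter fun g => ConjClasses.mk g = C).card := by
  classical
  have := Fintype.ofFinite (ConjClasses G)
  let N : ConjClasses G → ℂ := fun C => (Finset.univ.filter fun g => ConjClasses.mk g = C).card
  have hN : ∀ C, N C ≠ 0 := fun C => by
    obtain ⟨g, hg⟩ := ConjClasses.exists_rep C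
    exact Nat.cast_ne_zero.mpr (Finset.card_ne_zero_of_mem (a := g) (by simp [hg]))
  have hsum : ∀ χ : Irr G, ∑ g, χ.1 g = ∑ C, N C * χ.1 (Quotient.out C) := fun χ => by
    rw [← sum_comp_mk fun C => χ.1 (Quotient.out C)]
    simp only [χ.apply_out]
  -- Dividing by `N C` cancels the weight that C receives when a sum over G is grouped by classes.
  let F : ConjClasses G → ℂ := fun C => (N (τ C) - N C) / N C
  have hF : (fun g => F (ConjClasses.mk g)) = 0 := by
    refine eq_zero_of_sum_mul_irr_eq_zero _ (fun g x => ?_) fun χ => ?_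
    · rw [ConjClasses.mk_eq_mk_iff_isConj.mpr (isConj_iff.mpr ⟨x, rfl⟩ : IsConj g (x * g * x⁻¹))]
    · have h1 : ∑ g, (σ χ).1 g = ∑ g, χ.1 g := by
        rw [Irr.sum_apply, Irr.sum_apply]
        simp only [h.coe_eq_one_iff]
      rw [hsum, hsum, ← Equiv.sum_comp τ] at h1
      simp only [h.apply_out] at h1
      calc ∑ g, F (ConjClasses.mk g) * χ.1 g
          = ∑ g, (fun C => F C * χ.1 (Quotient.out C)) (ConjClasses.mk g) := by
            simp only [χ.apply_out]
        _ = ∑ C, N C * (F C * χ.1 (Quotient.out C)) :=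
            sum_comp_mk fun C => F C * χ.1 (Quotient.out C)
        _ = ∑ C, (N (τ C) * χ.1 (Quotient.out C) - N C * χ.1 (Quotient.out C)) := by
            refine Finset.sum_congr rfl fun C _ => ?_
            simp only [F]
            field_simp [hN C]
        _ = 0 := by rw [Finset.sum_sub_distrib, h1, sub_self]
  obtain ⟨g, rfl⟩ := ConjClasses.exists_rep C
  have h2 : F (ConjClasses.mk g) = 0 := congrFun hF g
  have h3 := sub_eq_zero.mp ((div_eq_zero_iff.mp h2).resolve_right (hN _))
  exact Nat.cast_injective (R := ℂ) h3

theorem sum_comp [Fintype G] (h : IsTableAutomorphism σ τ) (F : ConjClasses G → ℂ) :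
    ∑ g : G, F (τ (ConjClasses.mk g)) = ∑ g : G, F (ConjClasses.mk g) := by
  classical
  have := Fintype.ofFinite (ConjClasses G)
  rw [sum_comp_mk (fun C => F (τ C)), sum_comp_mk F,
    ← Equiv.sum_comp τ fun C => ((Finset.univ.filter fun g => ConjClasses.mk g = C).card : ℂ) * F C]
  simp only [h.card_class]

end

end IsTableAutomorphism

/-! ### Transport of invariant sets, block sums and the characters σ_X -/

theorem IsInvariant.mem_of_mk_eq {G : Type u} [Group G] {K : Set G} (hK : IsInvariant K)
    {g h : G} (hg : g ∈ K) (hgh : ConjClasses.mk g = ConjClasses.mk h) : h ∈ K := by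
  obtain ⟨c, rfl⟩ := isConj_iff.mp (ConjClasses.mk_eq_mk_iff_isConj.mp hgh)
  exact hK g hg c

/-- Invariance is essential: `blockImage` remembers only which classes meet K. -/
theorem mem_blockImage_iff {G : Type u} [Group G] {τ : Equiv.Perm (ConjClasses G)} {K : Set G}
    (hK : IsInvariant K) {g h : G} (hgh : ConjClasses.mk h = τ (ConjClasses.mk g)) :
    h ∈ blockImage τ K ↔ g ∈ K := by
  constructor
  · rintro ⟨k, hk, hkh⟩
    exact hK.mem_of_mk_eq hk (τ.injective (hkh.symm.trans hgh))
  · intro hg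
    exact ⟨g, hg, hgh⟩

theorem blockImage_injOn {G : Type u} [Group G] (τ : Equiv.Perm (ConjClasses G)) :
    Set.InjOn (blockImage τ) {K | IsInvariant K} := by
  intro K hK K' hK' hKK'
  ext g
  obtain ⟨h, hh⟩ := IsTableAutomorphism.exists_mk_eq τ g
  rw [← mem_blockImage_iff hK hh, hKK', mem_blockImage_iff hK' hh]

section

variable {G : Type u} [Group G] [Finite G] {σ : Equiv.Perm (Irr G)}
  {τ : Equiv.Perm (ConjClasses G)}

theorem linExt_blockImage (h : IsTableAutomorphism σ τ) {K : Set G} (hK : IsInvariant K)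
    (χ : Irr G) :
    linExt (σ χ).1 (blockSum (blockImage τ K)) = linExt χ.1 (blockSum K) := by
  classical
  have := Fintype.ofFinite G
  -- χ^σ cut off outside K^τ, as a function of classes; composed with τ it becomes χ cut off outside
  -- K.
  let F : ConjClasses G → ℂ := fun C =>
    if Quotient.out C ∈ blockImage τ K then (σ χ).1 (Quotient.out C) else 0
  have key : ∀ (ψ : Irr G) (S : Set G),
      linExt ψ.1 (blockSum S) = ∑ g, if g ∈ S then ψ.1 g else 0 := fun ψ S => by
    rw [linExt_blockSum, ← Finset.sum_filter]
    refine Finset.sum_congr ?_ fun _ _ => rfl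
    ext
    simp
  have hout : ∀ g : G, ConjClasses.mk (Quotient.out (ConjClasses.mk g)) = ConjClasses.mk g :=
    fun g => Quotient.out_eq _
  have hleft : ∀ g, F (ConjClasses.mk g) = if g ∈ blockImage τ K then (σ χ).1 g else 0 := by
    intro g
    obtain ⟨k, hk⟩ := IsTableAutomorphism.exists_eq_mk τ g
    simp only [F, (σ χ).apply_out, mem_blockImage_iff hK hk,
      mem_blockImage_iff hK ((hout g).trans hk)]
  have hright : ∀ g, F (τ (ConjClasses.mk g)) = if g ∈ K then χ.1 g else 0 := by
    intro g
    obtain ⟨k, hk⟩ := IsTableAutomorphism.exists_mk_eq τ g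
    rw [← hk, hleft, h χ g k hk]
    simp only [mem_blockImage_iff hK hk]
  rw [key, key]
  simp only [← hleft, ← hright]
  exact (h.sum_comp F).symm

theorem sigma_apply (X : Set (Irr G)) (g : G) :
    sigma X g = ∑ χ ∈ X.toFinite.toFinset, χ.1 1 * χ.1 g := by
  simp [sigma, Finset.sum_apply]

/-- The values match by definition of a table automorphism; the coefficients χ(1) match because
degrees are preserved. -/
theorem sigma_image (hστ : IsTableAutomorphism σ τ) (X : Set (Irr G)) {g h : G}
    (hgh : ConjClasses.mk h = τ (ConjClasses.mk g)) : sigma (σ '' X) h = sigma X g := by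
  rw [sigma_apply, sigma_apply]
  symm
  refine Finset.sum_bij (fun χ _ => σ χ) ?_ (fun _ _ _ _ h => σ.injective h) ?_ ?_
  · intro χ hχ
    simpa using hχ
  · intro ψ hψ
    obtain ⟨χ, hχ, rfl⟩ := (Set.Finite.mem_toFinset _).mp hψ
    exact ⟨χ, (Set.Finite.mem_toFinset _).mpr hχ, rfl⟩
  · intro χ _
    rw [hστ.apply_one, hστ χ g h hgh]

theorem sigma_conj (X : Set (Irr G)) (g x : G) : sigma X (x * g * x⁻¹) = sigma X g := by
  rw [sigma_apply, sigma_apply]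
  refine Finset.sum_congr rfl fun χ _ => ?_
  rw [χ.apply_eq_of_isConj (isConj_iff.mpr ⟨x, rfl⟩ : IsConj g (x * g * x⁻¹))]

/-! ### Transport of the class and character partitions -/

theorem clRel_irrImage_iff (hστ : IsTableAutomorphism σ τ) (𝒳 : Set (Set (Irr G))) {g g' h h' : G}
    (hh : ConjClasses.mk h = τ (ConjClasses.mk g))
    (hh' : ConjClasses.mk h' = τ (ConjClasses.mk g')) :
    clRel (irrImage σ 𝒳) h h' ↔ clRel 𝒳 g g' := by
  change (∀ X ∈ (fun X => σ '' X) '' 𝒳, sigma X h = sigma X h') ↔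
    ∀ X ∈ 𝒳, sigma X g = sigma X g'
  rw [Set.forall_mem_image]
  simp only [sigma_image hστ _ hh, sigma_image hστ _ hh']

theorem irRel_groupImage_iff (hστ : IsTableAutomorphism σ τ) {𝒦 : Set (Set G)}
    (h𝒦 : ∀ K ∈ 𝒦, IsInvariant K) (χ ψ : Irr G) :
    irRel (groupImage τ 𝒦) (σ χ) (σ ψ) ↔ irRel 𝒦 χ ψ := by
  change (∀ K ∈ blockImage τ '' 𝒦, linExt (σ χ).1 (blockSum K) / (σ χ).1 1 =
    linExt (σ ψ).1 (blockSum K) / (σ ψ).1 1) ↔ ∀ K ∈ 𝒦, _ = _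
  rw [Set.forall_mem_image]
  refine forall₂_congr fun K hK => ?_
  rw [linExt_blockImage hστ (h𝒦 K hK), linExt_blockImage hστ (h𝒦 K hK), hστ.apply_one,
    hστ.apply_one]

theorem Clpt_irrImage (hστ : IsTableAutomorphism σ τ) (𝒳 : Set (Set (Irr G))) :
    Clpt (irrImage σ 𝒳) = groupImage τ (Clpt 𝒳) := by
  have key : ∀ g h : G, ConjClasses.mk h = τ (ConjClasses.mk g) →
      blockImage τ {x | clRel 𝒳 x g} = {y | clRel (irrImage σ 𝒳) y h} := by
    intro g h hgh
    ext y
    constructor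
    · rintro ⟨x, hx, hxy⟩
      exact (clRel_irrImage_iff hστ 𝒳 hxy hgh).mpr hx
    · intro hy
      obtain ⟨x, hx⟩ := IsTableAutomorphism.exists_eq_mk τ y
      exact ⟨x, (clRel_irrImage_iff hστ 𝒳 hx hgh).mp hy, hx⟩
  ext K
  constructor
  · rintro ⟨h, rfl⟩
    obtain ⟨g, hg⟩ := IsTableAutomorphism.exists_eq_mk τ h
    exact ⟨_, ⟨g, rfl⟩, key g h hg⟩
  · rintro ⟨_, ⟨g, rfl⟩, rfl⟩
    obtain ⟨h, hh⟩ := IsTableAutomorphism.exists_mk_eq τ g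
    exact ⟨h, key g h hh⟩

theorem Irpt_groupImage (hστ : IsTableAutomorphism σ τ) {𝒦 : Set (Set G)}
    (h𝒦 : ∀ K ∈ 𝒦, IsInvariant K) :
    Irpt (groupImage τ 𝒦) = irrImage σ (Irpt 𝒦) := by
  have key : ∀ ψ : Irr G,
      σ '' {χ | irRel 𝒦 χ ψ} = {χ | irRel (groupImage τ 𝒦) χ (σ ψ)} := by
    intro ψ
    ext χ
    obtain ⟨χ, rfl⟩ := σ.surjective χ
    rw [σ.injective.mem_set_image]
    exact (irRel_groupImage_iff hστ h𝒦 χ ψ).symm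
  ext X
  constructor
  · rintro ⟨ψ, rfl⟩
    obtain ⟨ψ, rfl⟩ := σ.surjective ψ
    exact ⟨_, ⟨ψ, rfl⟩, key ψ⟩
  · rintro ⟨_, ⟨ψ, rfl⟩, rfl⟩
    exact ⟨σ ψ, key ψ⟩

/-! ### Supercharacter theories -/

/-- The characters `σ_X` of the parts of a partition of `Irr G` are linearly independent. -/
theorem linearIndependent_sigma {𝒳 : Set (Set (Irr G))} (h𝒳 : Setoid.IsPartition 𝒳) :
    LinearIndependent ℂ fun X : 𝒳 => sigma X.1 := by
  classical
  have := Fintype.ofFinite (Irr G)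
  have := Fintype.ofFinite 𝒳
  -- Coordinates of σ_X with respect to `Irr G`: distinct parts have disjoint nonempty supports,
  -- with nonzero entries there.
  let u : 𝒳 → Irr G → ℂ := fun X χ => if χ ∈ X.1 then χ.1 1 else 0
  have hu : LinearIndependent ℂ u := by
    rw [Fintype.linearIndependent_iff]
    intro c hc X
    obtain ⟨χ, hχ⟩ := Setoid.nonempty_of_mem_partition h𝒳 X.2
    have h1 := congrFun hc χ
    rw [Finset.sum_apply, Finset.sum_eq_single X] at h1
    · simpa [u, hχ, χ.apply_one_ne_zero] using h1
    · intro Y _ hY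
      have : χ ∉ Y.1 := fun hχY =>
        hY (Subtype.ext ((h𝒳.2 χ).unique ⟨Y.2, hχY⟩ ⟨X.2, hχ⟩))
      simp [u, this]
    · simp
  have hL := hu.map' (Fintype.linearCombination ℂ fun χ : Irr G => χ.1)
    (LinearMap.ker_eq_bot.mpr (linearIndependent_irr G).fintypeLinearCombination_injective)
  have hsigma : (fun X : 𝒳 => sigma X.1) =
      Fintype.linearCombination ℂ (fun χ : Irr G => χ.1) ∘ u := by
    funext X
    simp only [Function.comp_apply, Fintype.linearCombination_apply, u, ite_smul, zero_smul]
    rw [← Finset.sum_filter, sigma]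
    refine Finset.sum_congr ?_ fun _ _ => rfl
    ext
    simp
  rw [hsigma]
  exact hL

/-- A dimension count: the independent σ_X are as many as the blocks, so they span all functions
constant on blocks. Block indicators are therefore class functions. -/
theorem IsSupercharacterTheory.isInvariant {𝒳 : Set (Set (Irr G))} {𝒦 : Set (Set G)}
    (h : IsSupercharacterTheory 𝒳 𝒦) : ∀ K ∈ 𝒦, IsInvariant K := by
  classical
  have := Fintype.ofFinite 𝒳
  have := Fintype.ofFinite 𝒦
  have hblock : ∀ g : G, ∃ K : 𝒦, g ∈ K.1 := fun g => by
    obtain ⟨K, ⟨hK, hg⟩, -⟩ := h.isPartition_group.2 g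
    exact ⟨⟨K, hK⟩, hg⟩
  choose block hblock using hblock
  choose rep hrep using fun K : 𝒦 => Setoid.nonempty_of_mem_partition h.isPartition_group K.2
  let v : 𝒳 → 𝒦 → ℂ := fun X K => sigma X.1 (rep K)
  have hv : ∀ X g, v X (block g) = sigma X.1 g := fun X g =>
    h.constant X.1 X.2 (block g).1 (block g).2 _ (hrep _) _ (hblock g)
  have hli : LinearIndependent ℂ v := by
    -- Pulling `v X` back along `block` recovers σ_X on G.
    refine LinearIndependent.of_comp (LinearMap.funLeft ℂ ℂ block) ?_
    convert linearIndependent_sigma h.isPartition_irr using 1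
    funext X g
    exact hv X g
  have hspan : Submodule.span ℂ (Set.range v) = ⊤ := by
    refine hli.span_eq_top_of_card_eq_finrank' ?_
    rw [Module.finrank_fintype_fun_eq_card, ← Nat.card_eq_fintype_card,
      ← Nat.card_eq_fintype_card]
    exact h.ncard_eq
  have hclass : ∀ (b : 𝒦 → ℂ) (g x : G), b (block (x * g * x⁻¹)) = b (block g) := by
    intro b g x
    have hb : b ∈ Submodule.span ℂ (Set.range v) := hspan ▸ Submodule.mem_top
    induction hb using Submodule.span_induction with
    | mem b hb =>
      obtain ⟨X, rfl⟩ := hb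
      rw [hv, hv, sigma_conj]
    | zero => rfl
    | add a b _ _ ha hb => rw [Pi.add_apply, Pi.add_apply, ha, hb]
    | smul c a _ ha => rw [Pi.smul_apply, Pi.smul_apply, ha]
  intro K hK g hg x
  have hgK : block g = ⟨K, hK⟩ :=
    Subtype.ext ((h.isPartition_group.2 g).unique ⟨(block g).2, hblock g⟩ ⟨hK, hg⟩)
  have h1 := hclass (Pi.single ⟨K, hK⟩ 1) g x
  rw [hgK, Pi.single_eq_same] at h1
  have h2 : block (x * g * x⁻¹) = ⟨K, hK⟩ := by
    by_contra hne
    rw [Pi.single_eq_of_ne hne] at h1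
    exact zero_ne_one h1
  have h3 := hblock (x * g * x⁻¹)
  rwa [h2] at h3

/-- Invariance of the blocks enters twice: it keeps the sets K^τ disjoint, and it keeps them
distinct so that the cardinalities still agree. -/
theorem IsSupercharacterTheory.image (hστ : IsTableAutomorphism σ τ) {𝒳 : Set (Set (Irr G))}
    {𝒦 : Set (Set G)} (h : IsSupercharacterTheory 𝒳 𝒦) :
    IsSupercharacterTheory (irrImage σ 𝒳) (groupImage τ 𝒦) where
  isPartition_irr := by
    constructor
    · rintro ⟨X, hX, hX0⟩
      exact h.isPartition_irr.1 (Set.image_eq_empty.mp hX0 ▸ hX)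
    · intro χ
      obtain ⟨χ, rfl⟩ := σ.surjective χ
      obtain ⟨X, ⟨hX, hχ⟩, huniq⟩ := h.isPartition_irr.2 χ
      refine ⟨σ '' X, ⟨⟨X, hX, rfl⟩, Set.mem_image_of_mem σ hχ⟩, ?_⟩
      rintro _ ⟨⟨Y, hY, rfl⟩, hχY⟩
      have := huniq Y ⟨hY, σ.injective.mem_set_image.mp hχY⟩
      rw [this]
  isPartition_group := by
    constructor
    · rintro ⟨K, hK, hK0⟩
      obtain ⟨g, hg⟩ := Setoid.nonempty_of_mem_partition h.isPartition_group hK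
      obtain ⟨k, hk⟩ := IsTableAutomorphism.exists_mk_eq τ g
      have hk0 : k ∈ blockImage τ K := ⟨g, hg, hk⟩
      rw [hK0] at hk0
      exact hk0
    · intro k
      obtain ⟨g, hg⟩ := IsTableAutomorphism.exists_eq_mk τ k
      obtain ⟨K, ⟨hK, hgK⟩, huniq⟩ := h.isPartition_group.2 g
      refine ⟨blockImage τ K, ⟨⟨K, hK, rfl⟩, g, hgK, hg⟩, ?_⟩
      rintro _ ⟨⟨L, hL, rfl⟩, hkL⟩
      rw [huniq L ⟨hL, (mem_blockImage_iff (h.isInvariant L hL) hg).mp hkL⟩]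
  ncard_eq := by
    unfold irrImage groupImage
    rw [Set.ncard_image_of_injective _ σ.injective.image_injective,
      ((blockImage_injOn τ).mono h.isInvariant).ncard_image, h.ncard_eq]
  constant := by
    rintro _ ⟨X, hX, rfl⟩ _ ⟨K, hK, rfl⟩ k ⟨g, hg, hgk⟩ k' ⟨g', hg', hgk'⟩
    exact (sigma_image hστ X hgk).trans
      ((h.constant X hX K hK g hg g' hg').trans (sigma_image hστ X hgk').symm)

end

end Supercharacter

theorem mainTheorem10 {G : Type*} [Group G] [Finite G]
    (σ : Equiv.Perm (Supercharacter.Irr G)) (τ : Equiv.Perm (ConjClasses G))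
    (hστ : Supercharacter.IsTableAutomorphism σ τ) :
    (∀ 𝒳 : Set (Set (Supercharacter.Irr G)),
      Supercharacter.Clpt (Supercharacter.irrImage σ 𝒳) =
        Supercharacter.groupImage τ (Supercharacter.Clpt 𝒳)) ∧
    (∀ 𝒦 : Set (Set G), (∀ K ∈ 𝒦, Supercharacter.IsInvariant K) →
      Supercharacter.Irpt (Supercharacter.groupImage τ 𝒦) =
        Supercharacter.irrImage σ (Supercharacter.Irpt 𝒦)) ∧
    (∀ (𝒳 : Set (Set (Supercharacter.Irr G))) (𝒦 : Set (Set G)),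
      Supercharacter.IsSupercharacterTheory 𝒳 𝒦 →
        Supercharacter.IsSupercharacterTheory
          (Supercharacter.irrImage σ 𝒳) (Supercharacter.groupImage τ 𝒦)) := by
  exact ⟨Supercharacter.Clpt_irrImage hστ,
    fun _ h𝒦 => Supercharacter.Irpt_groupImage hστ h𝒦,
    fun _ _ h => h.image hστ⟩
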